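/- Let $\theta\in(0,\frac{\pi}{4})$, $s=\sin\theta\cos\theta$, $t=\sin^2\theta$, and let $\mathcal R=[0,1]^2$ be the unit square with centre $Z=(\frac12,\frac12)$ and vertices $E_1=(0,0)$, $E_2=(1,0)$, $E_3=(1,1)$, $E_4=(0,1)$. Put $$P_1=(s,t),\quad P_2=(1-t,s),\quad P_3=(1-s,1-t),\quad P_4=(t,1-s),$$ $$P_1'=(1-s,t),\quad P_2'=(1-t,1-s),\quad P_3'=(s,1-t),\quad P_4'=(t,s).$$ With indices $i\in\{1,2,3,4\}$ taken cyclically, $\mathcal R$ is divided into the closed triangles $\mathcal A_i=\Delta(E_i,E_{i+1},P_i)$ and $\mathcal B_i=\Delta(E_i,P_i,P_{i-1})$ and the closed centre square $\mathcal C$ with vertices $P_1,P_2,P_3,P_4$. Let $F=F_\theta\colon\mathcal R\to\mathcal R$ be the map with $F(E_i)=E_i$ and $F(P_i)=P_i'$ for all $i$ which is affine on each of these nine pieces. Let $R$ be the rotation about $Z$ by the angle $\frac{\pi}{2}$. A rotationally symmetric invariant circle is a simple closed curve $\Gamma\subset\mathcal R$ with $F(\Gamma)=\Gamma$ which encircles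 $Z$ (that is, $Z\notin\Gamma$ and $Z$ lies in the bounded component of the complement of $\Gamma$), on which $F$ preserves the $S^1$-order of points, and with $R(\Gamma)=\Gamma$. **Proposition.** Let $\Gamma$ be a rotationally symmetric invariant circle disjoint from $\mathcal C$. For each $i$ let $U_i$ denote the intersection points of $\Gamma$ with the break segment $\mathcal B_i\cap\mathcal A_i=\overline{E_iP_i}$, and $V_i$ those with the break segment $\mathcal A_i\cap\mathcal B_{i+1}=\overline{E_{i+1}P_i}$. Then $F|_\Gamma$ is periodic (that is, there is $q\ge 1$ with $F^q(x)=x$ for all $x\in\Gamma$) if and only if, for every $i$, the $F$-orbits of $U_i$ and $V_i$ are periodic. -/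

import Mathlib

namespace SquareMap

/-! The parameter is an angle `θ ∈ (0, π/4)`. The cyclic index set is `Fin 4` with its
wrap-around addition: the vertices, pieces and break points usually numbered `1, 2, 3, 4` are
numbered `0, 1, 2, 3` here. -/

/-- The unit square `[0,1] × [0,1]`. -/
def rect : Set (ℝ × ℝ) := Set.Icc 0 1 ×ˢ Set.Icc 0 1

/-- The centre `Z` of the unit square. -/
noncomputable def Z : ℝ × ℝ := (1 / 2, 1 / 2)

/-- The counterclockwise rotation about `Z` by the angle `π/2`. -/
def rot (p : ℝ × ℝ) : ℝ × ℝ := (1 - p.2, p.1)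

/-- The clockwise rotation about `Z` by the angle `π/2`, the inverse of `rot`. -/
def rotInv (p : ℝ × ℝ) : ℝ × ℝ := (p.2, 1 - p.1)

/-- The abscissa of the first vertex of the inner square. -/
noncomputable def s (θ : ℝ) : ℝ := Real.sin θ * Real.cos θ

/-- The ordinate of the first vertex of the inner square. -/
noncomputable def t (θ : ℝ) : ℝ := Real.sin θ ^ 2

theorem st_rel (θ : ℝ) : s θ ^ 2 = t θ - t θ ^ 2 := by
  simp only [s, t, mul_pow, Real.cos_sq']; ring

theorem t_pos {θ : ℝ} (hθ : θ ∈ Set.Ioo 0 (Real.pi / 4)) : 0 < t θ :=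
  pow_pos (Real.sin_pos_of_pos_of_lt_pi hθ.1 (by linarith [hθ.2, Real.pi_pos])) 2

theorem t_lt_s {θ : ℝ} (hθ : θ ∈ Set.Ioo 0 (Real.pi / 4)) : t θ < s θ := by
  have hs := Real.sin_pos_of_pos_of_lt_pi hθ.1 (by linarith [hθ.2, Real.pi_pos])
  have hc : Real.sin θ < Real.cos θ := by
    rw [← Real.sin_pi_div_two_sub]
    exact Real.sin_lt_sin_of_lt_of_le_pi_div_two (by linarith [hθ.1, Real.pi_pos])
      (by linarith [hθ.1]) (by linarith [hθ.2])
  unfold s t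
  nlinarith

/-- The vertices of the unit square, counterclockwise from the origin. -/
def E : Fin 4 → ℝ × ℝ := ![(0, 0), (1, 0), (1, 1), (0, 1)]

/-- The ray starting at the vertex `E i` and making the (counterclockwise) angle `θ` with the
side from `E i` to `E (i + 1)`. -/
noncomputable def ray (θ : ℝ) (i : Fin 4) : Set (ℝ × ℝ) :=
  {p | ∃ r : ℝ, 0 ≤ r ∧
    p = E i + r • (Real.cos θ • (E (i + 1) - E i) + Real.sin θ • (E (i - 1) - E i))}

/-- The vertices of the inner square: `P θ i` is the intersection point of the rays
`ray θ (i - 1)` and `ray θ i`, in coordinates. -/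
noncomputable def P (θ : ℝ) : Fin 4 → ℝ × ℝ :=
  ![(s θ, t θ), (1 - t θ, s θ), (1 - s θ, 1 - t θ), (t θ, 1 - s θ)]

theorem P_mem_ray {θ : ℝ} (hθ : θ ∈ Set.Ioo 0 (Real.pi / 4)) (i : Fin 4) : P θ i ∈ ray θ (i - 1) ∩ ray θ i := by
  have hs := Real.sin_pos_of_pos_of_lt_pi hθ.1 (by linarith [hθ.2, Real.pi_pos])
  have hc : 0 < Real.cos θ := Real.cos_pos_of_mem_Ioo ⟨by linarith [hθ.1, Real.pi_pos], by linarith [hθ.2, Real.pi_pos]⟩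
  have h := Real.sin_sq_add_cos_sq θ
  refine ⟨⟨Real.cos θ, hc.le, ?_⟩, ⟨Real.sin θ, hs.le, ?_⟩⟩ <;>
  fin_cases i <;> ext <;> simp [E, P, s, t, show (-1 - 1 : Fin 4) = 2 from rfl] <;> linarith

/-- The vertices of the inner square of the construction in reverse orientation (the mirror image
of the first one under `(x, y) ↦ (1 - x, y)`), counterclockwise, starting with the vertex that has
the same ordinate as `P θ 0`. -/
noncomputable def P' (θ : ℝ) : Fin 4 → ℝ × ℝ :=
  ![(1 - s θ, t θ), (1 - t θ, 1 - s θ), (s θ, 1 - t θ), (t θ, s θ)]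

/-- The triangle with vertices `E i`, `E (i + 1)`, `P i`, adjacent to a side of the square. -/
noncomputable def pieceA (θ : ℝ) (i : Fin 4) : Set (ℝ × ℝ) :=
  convexHull ℝ {E i, E (i + 1), P θ i}

/-- The triangle with vertices `E i`, `P i`, `P (i - 1)`. -/
noncomputable def pieceB (θ : ℝ) (i : Fin 4) : Set (ℝ × ℝ) :=
  convexHull ℝ {E i, P θ i, P θ (i - 1)}

/-- The (closed) centre square. -/
noncomputable def pieceC (θ : ℝ) : Set (ℝ × ℝ) :=
  convexHull ℝ {P θ 0, P θ 1, P θ 2, P θ 3}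

/-- The shear fixing `E 0`, `E 1` and mapping `P 0` to `P' 0`. -/
noncomputable def shear (θ : ℝ) (p : ℝ × ℝ) : ℝ × ℝ :=
  (p.1 + (1 - 2 * s θ) / t θ * p.2, p.2)

/-- The linear map fixing `E 0` and mapping `P 0` to `P' 0` and `P 3` to `P' 3`. -/
noncomputable def scaling (θ : ℝ) (p : ℝ × ℝ) : ℝ × ℝ :=
  (((t θ ^ 2 - (1 - s θ) ^ 2) * p.1 + (1 - 2 * s θ) * t θ * p.2) / (t θ - s θ),
    ((2 * s θ - 1) * t θ * p.1 + (2 * t θ - 1) * t θ * p.2) / (t θ - s θ))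

/-- The affine map on `pieceA θ i`, which is `pieceA θ 0` rotated by `i` quarter turns. -/
noncomputable def mapA (θ : ℝ) (i : Fin 4) (p : ℝ × ℝ) : ℝ × ℝ :=
  rot^[(i : ℕ)] (shear θ (rotInv^[(i : ℕ)] p))

/-- The affine map on `pieceB θ i`, which is `pieceB θ 0` rotated by `i` quarter turns. -/
noncomputable def mapB (θ : ℝ) (i : Fin 4) (p : ℝ × ℝ) : ℝ × ℝ :=
  rot^[(i : ℕ)] (scaling θ (rotInv^[(i : ℕ)] p))

/-- The affine map on `pieceC θ`, the rotation about `Z` mapping each `P i` to `P' i`. -/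
noncomputable def mapC (θ : ℝ) (p : ℝ × ℝ) : ℝ × ℝ :=
  (2 * s θ * p.1 + (2 * t θ - 1) * p.2 + (1 - t θ - s θ),
    (1 - 2 * t θ) * p.1 + 2 * s θ * p.2 + (t θ - s θ))

theorem mapA_vertices {θ : ℝ} (hθ : θ ∈ Set.Ioo 0 (Real.pi / 4)) (i : Fin 4) :
    mapA θ i (E i) = E i ∧ mapA θ i (E (i + 1)) = E (i + 1) ∧ mapA θ i (P θ i) = P' θ i := by
  have ht := (t_pos hθ).ne'
  fin_cases i <;> simp [mapA, shear, rot, rotInv, E, P, P', ht] <;> ring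

theorem mapB_vertices {θ : ℝ} (hθ : θ ∈ Set.Ioo 0 (Real.pi / 4)) (i : Fin 4) :
    mapB θ i (E i) = E i ∧ mapB θ i (P θ i) = P' θ i ∧
      mapB θ i (P θ (i - 1)) = P' θ (i - 1) := by
  have hst : t θ - s θ ≠ 0 := (sub_neg.2 (t_lt_s hθ)).ne
  have h := st_rel θ
  have h1 : scaling θ (s θ, t θ) = (1 - s θ, t θ) := by
    ext <;> simp only [scaling] <;> rw [div_eq_iff hst]
    · linear_combination (1 - s θ) * h
    · linear_combination (2 * t θ) * h
  have h2 : scaling θ (t θ, 1 - s θ) = (t θ, s θ) := by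
    ext <;> simp only [scaling] <;> rw [div_eq_iff hst]
    · linear_combination (t θ) * h
    · linear_combination h
  have h0 : scaling θ (0, 0) = (0, 0) := by simp [scaling]
  fin_cases i <;> simp [mapB, rot, rotInv, E, P, P', h0, h1, h2]

theorem mapC_vertices (θ : ℝ) (i : Fin 4) : mapC θ (P θ i) = P' θ i := by
  have h := st_rel θ
  fin_cases i <;> ext <;> simp [mapC, P, P'] <;> linarith

open Classical in
/-- The piecewise affine map `F = F_θ` of the unit square: the continuous map which fixes the
`E i`, maps each `P i` to `P' i`, and is affine on each of the nine pieces. Affine maps of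
adjacent pieces agree at the end points of the common edge (see the three facts above), hence on
that edge, so the order of the cases is immaterial. Outside the unit square the value is
irrelevant; there it is set to the identity. -/
noncomputable def F (θ : ℝ) (p : ℝ × ℝ) : ℝ × ℝ :=
  if p ∈ pieceA θ 0 then mapA θ 0 p
  else if p ∈ pieceA θ 1 then mapA θ 1 p
  else if p ∈ pieceA θ 2 then mapA θ 2 p
  else if p ∈ pieceA θ 3 then mapA θ 3 p
  else if p ∈ pieceB θ 0 then mapB θ 0 p
  else if p ∈ pieceB θ 1 then mapB θ 1 p
  else if p ∈ pieceB θ 2 then mapB θ 2 p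
  else if p ∈ pieceB θ 3 then mapB θ 3 p
  else if p ∈ pieceC θ then mapC θ p
  else p

/-- `Γ` is a rotationally symmetric invariant circle of `F θ`: a simple closed curve in the unit
square, invariant under `F θ`, encircling `Z`, on which `F θ` preserves the cyclic order of
points, and which is mapped to itself by the quarter turn about `Z`. -/
structure IsRotSymmInvariantCircle (θ : ℝ) (Γ : Set (ℝ × ℝ)) : Prop where
  subset_rect : Γ ⊆ rect
  invariant : F θ '' Γ = Γ
  /-- `Z` lies in a bounded component of the complement of `Γ`. -/
  encircles : Z ∉ Γ ∧ Bornology.IsBounded (connectedComponentIn Γᶜ Z)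
  /-- `Γ` has an injective continuous parametrization `γ` by the circle `ℝ/ℤ`, in which `F θ`
  lifts to a monotone map `g : ℝ → ℝ` with `g (x + 1) = g x + 1`; that is, `Γ` is a simple closed
  curve and `F θ` preserves the cyclic order on it. -/
  circle : ∃ γ : UnitAddCircle → ℝ × ℝ, Continuous γ ∧ Function.Injective γ ∧ Set.range γ = Γ ∧
    ∃ g : CircleDeg1Lift, ∀ x : ℝ, F θ (γ (x : UnitAddCircle)) = γ ((g x : ℝ) : UnitAddCircle)
  rot_symm : rot '' Γ = Γ

/-- The intersection of `Γ` with the break segment between `pieceB θ i` and `pieceA θ i`,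
consisting of the break point `U i`. -/
def breakU (θ : ℝ) (Γ : Set (ℝ × ℝ)) (i : Fin 4) : Set (ℝ × ℝ) :=
  Γ ∩ (pieceB θ i ∩ pieceA θ i)

/-- The intersection of `Γ` with the break segment between `pieceA θ i` and `pieceB θ (i + 1)`,
consisting of the break point `V i`. -/
def breakV (θ : ℝ) (Γ : Set (ℝ × ℝ)) (i : Fin 4) : Set (ℝ × ℝ) :=
  Γ ∩ (pieceA θ i ∩ pieceB θ (i + 1))

/-- The restriction of `f` to the invariant set `Γ` is periodic: some positive iterate of it is
the identity of `Γ`. -/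
def IsPeriodicOn (f : ℝ × ℝ → ℝ × ℝ) (Γ : Set (ℝ × ℝ)) : Prop :=
  ∃ q : ℕ, 0 < q ∧ ∀ p ∈ Γ, f^[q] p = p

end SquareMap

namespace SquareMap

open Function Set

/-! ### Rotation equivariance of the pieces -/

/-! Only the passage from periodic break points to periodicity of the whole curve needs an argument.
Lift the circle map to a monotone `g` on the line. Periodic points share one rotation number, so a
single pair `n`, `m` satisfies `(g ^ n) x = x + m` at all break points
(`circleDeg1Lift_pow_eq_add_int`). There are at least two of these: a connected curve avoiding the
break segments and the centre square would lie in one triangle, which the quarter turn forbids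
(`exists_mem_breakSet`), and the quarter turn of a break point is another one.

Suppose some point is not fixed by `g ^ n - m`, and take the gap between the adjacent fixed points
around it. No iterate of this gap meets a break segment, so on the arc above it the `n`-th iterate
of `F θ` is one affine map (`IsCurveLift.exists_iterate_eq`). All affine pieces met by the curve
have determinant `1`, and the two ends of the arc are distinct fixed points, so this map is a shear.
Points moved by a shear escape to infinity, but the arc stays in the square
(`IsSpecialAffine.eq_of_bounded`), hence every point of the arc is fixed: a contradiction. -/

theorem rotInv_rot (p : ℝ × ℝ) : rotInv (rot p) = p := by simp [rot, rotInv]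

theorem rot_rotInv (p : ℝ × ℝ) : rot (rotInv p) = p := by simp [rot, rotInv]

theorem image_rot_convexHull (s : Set (ℝ × ℝ)) :
    rot '' convexHull ℝ s = convexHull ℝ (rot '' s) := by
  let f : ℝ × ℝ →ᵃ[ℝ] ℝ × ℝ :=
    { toFun := rot
      linear := (-LinearMap.snd ℝ ℝ ℝ).prod (LinearMap.fst ℝ ℝ ℝ)
      map_vadd' := fun p v => by ext <;> simp [rot]; ring }
  exact f.image_convexHull s

theorem rot_E (i : Fin 4) : rot (E i) = E (i + 1) := by
  fin_cases i <;> simp [rot, E]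

theorem rot_P (θ : ℝ) (i : Fin 4) : rot (P θ i) = P θ (i + 1) := by
  fin_cases i <;> simp [rot, P]

theorem rot_mem_image_iff {p : ℝ × ℝ} {A B : Set (ℝ × ℝ)} (h : rot '' A = B) :
    rot p ∈ B ↔ p ∈ A := by
  rw [← h, (LeftInverse.injective rotInv_rot).mem_set_image]

theorem rot_mem_pieceA {θ : ℝ} {i : Fin 4} {p : ℝ × ℝ} :
    rot p ∈ pieceA θ (i + 1) ↔ p ∈ pieceA θ i := by
  refine rot_mem_image_iff ?_
  simp only [pieceA, image_rot_convexHull, image_insert_eq, image_singleton, rot_E, rot_P]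

theorem rot_mem_pieceB {θ : ℝ} {i : Fin 4} {p : ℝ × ℝ} :
    rot p ∈ pieceB θ (i + 1) ↔ p ∈ pieceB θ i := by
  refine rot_mem_image_iff ?_
  simp only [pieceB, image_rot_convexHull, image_insert_eq, image_singleton, rot_E, rot_P,
    sub_add_eq_add_sub]

theorem rot_mem_pieceC {θ : ℝ} {p : ℝ × ℝ} : rot p ∈ pieceC θ ↔ p ∈ pieceC θ := by
  refine rot_mem_image_iff ?_
  simp only [pieceC, image_rot_convexHull, image_insert_eq, image_singleton, rot_P]
  congr 1
  ext q
  simp [show (2 : Fin 4) + 1 = 3 from rfl, show (3 : Fin 4) + 1 = 0 from rfl,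
    show (1 : Fin 4) + 1 = 2 from rfl]
  tauto

/-- The eight triangles `pieceA θ i` (for `k = (i, true)`) and `pieceB θ i` (for
`k = (i, false)`). -/
noncomputable def piece (θ : ℝ) : Fin 4 × Bool → Set (ℝ × ℝ)
  | (i, true) => pieceA θ i
  | (i, false) => pieceB θ i

theorem rot_mem_piece {θ : ℝ} {i : Fin 4} {b : Bool} {p : ℝ × ℝ} :
    rot p ∈ piece θ (i + 1, b) ↔ p ∈ piece θ (i, b) := by
  cases b
  · exact rot_mem_pieceB
  · exact rot_mem_pieceA

/-- The union of the eight break segments. -/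
def breakSet (θ : ℝ) : Set (ℝ × ℝ) :=
  {p | ∃ i : Fin 4, p ∈ pieceB θ i ∩ pieceA θ i ∨ p ∈ pieceA θ i ∩ pieceB θ (i + 1)}

theorem rot_mem_breakSet {θ : ℝ} {p : ℝ × ℝ} : rot p ∈ breakSet θ ↔ p ∈ breakSet θ := by
  constructor
  · rintro ⟨i, h⟩
    refine ⟨i - 1, ?_⟩
    obtain ⟨j, rfl⟩ : ∃ j, i = j + 1 := ⟨i - 1, by simp⟩
    simpa only [mem_inter_iff, rot_mem_pieceA, rot_mem_pieceB, add_sub_cancel_right] using h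
  · rintro ⟨i, h⟩
    exact ⟨i + 1, by simpa only [mem_inter_iff, rot_mem_pieceA, rot_mem_pieceB] using h⟩

theorem isClosed_piece (θ : ℝ) (k : Fin 4 × Bool) : IsClosed (piece θ k) := by
  obtain ⟨i, _ | _⟩ := k
  · exact (Set.toFinite _).isClosed_convexHull ℝ
  · exact (Set.toFinite _).isClosed_convexHull ℝ

/-! ### The pieces as intersections of half planes -/

theorem mem_convexHull_triple {a b c p : ℝ × ℝ} : p ∈ convexHull ℝ {a, b, c} ↔
    ∃ α β γ : ℝ, 0 ≤ α ∧ 0 ≤ β ∧ 0 ≤ γ ∧ α + β + γ = 1 ∧ α • a + β • b + γ • c = p := by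
  constructor
  · intro h
    rw [convexHull_insert (insert_nonempty _ _), convexHull_pair, convexJoin_singleton_left] at h
    simp only [mem_iUnion] at h
    obtain ⟨q, ⟨u, v, hu, hv, huv, rfl⟩, ⟨u', v', hu', hv', huv', rfl⟩⟩ := h
    refine ⟨u', v' * u, v' * v, hu', by positivity, by positivity, ?_, ?_⟩
    · linear_combination huv' + v' * huv
    · simp only [smul_add, smul_smul, add_assoc]
  · rintro ⟨α, β, γ, hα, hβ, hγ, h1, rfl⟩
    have hs := convex_convexHull ℝ ({a, b, c} : Set (ℝ × ℝ))
    have hm : ∀ i : Fin 3, ![a, b, c] i ∈ convexHull ℝ ({a, b, c} : Set (ℝ × ℝ)) := by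
      intro i; apply subset_convexHull; fin_cases i <;> simp
    have := hs.sum_mem (t := Finset.univ) (w := ![α, β, γ]) (z := ![a, b, c])
      (by intro i _; fin_cases i <;> simpa) (by simpa [Fin.sum_univ_three] using h1)
      (fun i _ => hm i)
    simpa [Fin.sum_univ_three] using this

variable {θ : ℝ}

theorem s_add_t_lt_one (hθ : θ ∈ Ioo 0 (Real.pi / 4)) : s θ + t θ < 1 := by
  nlinarith [st_rel θ, t_pos hθ, t_lt_s hθ]

theorem two_mul_t_lt_one (hθ : θ ∈ Ioo 0 (Real.pi / 4)) : 2 * t θ < 1 := by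
  nlinarith [st_rel θ, t_pos hθ, t_lt_s hθ]

theorem mem_pieceA_zero (hθ : θ ∈ Ioo 0 (Real.pi / 4)) {p : ℝ × ℝ} :
    p ∈ pieceA θ 0 ↔ 0 ≤ p.2 ∧ s θ * p.2 ≤ t θ * p.1 ∧
      (1 - s θ) * p.2 ≤ t θ * (1 - p.1) := by
  have ht := t_pos hθ
  have hst := t_lt_s hθ
  have h1 := s_add_t_lt_one hθ
  rw [pieceA, mem_convexHull_triple]
  constructor
  · rintro ⟨α, β, γ, hα, hβ, hγ, h, rfl⟩
    obtain rfl : α = 1 - β - γ := by linarith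
    simp only [zero_add, E, P, Prod.fst_add, Prod.snd_add, Prod.smul_fst, Prod.smul_snd,
      Matrix.cons_val_zero, Matrix.cons_val_one, smul_eq_mul]
    exact ⟨by nlinarith, by nlinarith, by nlinarith⟩
  · rintro ⟨h0, h2, h3⟩
    obtain ⟨x, y⟩ := p
    dsimp only at h0 h2 h3
    -- The barycentric coordinates: the slacks of the three inequalities, normalised.
    refine ⟨(t θ * (1 - x) - (1 - s θ) * y) / t θ, (t θ * x - s θ * y) / t θ, y / t θ,
      div_nonneg (by linarith) ht.le, div_nonneg (by linarith) ht.le, div_nonneg h0 ht.le, ?_, ?_⟩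
    · field_simp; ring
    · ext <;> simp [E, P] <;> field_simp <;> ring

theorem mem_pieceB_zero (hθ : θ ∈ Ioo 0 (Real.pi / 4)) {p : ℝ × ℝ} :
    p ∈ pieceB θ 0 ↔ t θ * p.1 ≤ s θ * p.2 ∧ s θ * p.1 + t θ * p.2 ≤ t θ ∧
      t θ * p.2 ≤ (1 - s θ) * p.1 := by
  have ht := t_pos hθ
  have hst := t_lt_s hθ
  have h1 := s_add_t_lt_one hθ
  have hrel := st_rel θ
  have hd : 0 < s θ - t θ := by linarith
  rw [pieceB, mem_convexHull_triple]
  constructor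
  · rintro ⟨α, β, γ, hα, hβ, hγ, h, rfl⟩
    obtain rfl : α = 1 - β - γ := by linarith
    simp [E, P]
    refine ⟨?_, ?_, ?_⟩
    · nlinarith [mul_nonneg hγ hd.le]
    · nlinarith [mul_nonneg hγ hd.le]
    · nlinarith [mul_nonneg hβ hd.le]
  · rintro ⟨h0, h2, h3⟩
    obtain ⟨x, y⟩ := p
    dsimp only at h0 h2 h3
    -- Barycentric coordinates again; the determinant of `P θ 0` and `P θ 3` is `s (1 - s) - t ^ 2 =
    -- s - t` by `st_rel`.
    refine ⟨(t θ - s θ * x - t θ * y) / t θ, ((1 - s θ) * x - t θ * y) / (s θ - t θ),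
      (s θ * y - t θ * x) / (s θ - t θ), div_nonneg (by linarith) ht.le,
      div_nonneg (by linarith) hd.le, div_nonneg (by linarith) hd.le, ?_, ?_⟩
    · have := hd.ne'
      field_simp
      linear_combination (-x) * hrel
    · have := hd.ne'
      ext <;> simp [E, P] <;> field_simp
      · linear_combination (-x) * hrel
      · linear_combination (-y) * hrel

theorem P_mem_pieceC (i : Fin 4) : P θ i ∈ pieceC θ := by
  apply subset_convexHull; fin_cases i <;> simp

/-- The sides of the centre square lie on the four rays. In the proof `u` and `v` are the
coordinates along the sides from `P θ 0` to `P θ 1` and to `P θ 3`. -/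
theorem mem_pieceC_of_le (hθ : θ ∈ Ioo 0 (Real.pi / 4)) {p : ℝ × ℝ}
    (h0 : t θ * p.1 ≤ s θ * p.2) (h1 : t θ * p.2 ≤ s θ * (1 - p.1))
    (h2 : t θ * (1 - p.1) ≤ s θ * (1 - p.2)) (h3 : t θ * (1 - p.2) ≤ s θ * p.1) :
    p ∈ pieceC θ := by
  have hrel := st_rel θ
  have hd : 0 < s θ - t θ := by linarith [t_lt_s hθ]
  have hP := P_mem_pieceC (θ := θ)
  have hC : Convex ℝ (pieceC θ) := convex_convexHull ℝ _
  obtain ⟨x, y⟩ := p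
  dsimp only at h0 h1 h2 h3
  set u := (s θ * x - t θ * (1 - y)) / (s θ - t θ) with hu
  set v := (s θ * y - t θ * x) / (s θ - t θ) with hv
  have hu0 : 0 ≤ u := div_nonneg (by linarith) hd.le
  have hv0 : 0 ≤ v := div_nonneg (by linarith) hd.le
  have hu1 : 0 ≤ 1 - u := by rw [sub_nonneg, hu, div_le_one hd]; linarith
  have hv1 : 0 ≤ 1 - v := by rw [sub_nonneg, hv, div_le_one hd]; linarith
  have e1 := hC (hP 0) (hP 1) hu1 hu0 (by ring)
  have e2 := hC (hP 3) (hP 2) hu1 hu0 (by ring)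
  have e3 := hC e1 e2 hv1 hv0 (by ring)
  convert e3 using 1
  have := hd.ne'
  ext <;> simp [P, hu, hv] <;> field_simp
  · linear_combination ((s θ - t θ) * (x + y - 1)) * hrel
  · linear_combination ((s θ - t θ) * (y - x)) * hrel

/-- The rays from `E 0` and `E 1` bound the triangle `E 0`, `E 1`, `P θ 1`, which the segment from
`E 1` to `P θ 0` cuts into the two pieces. -/
theorem exists_rect_cover_zero (hθ : θ ∈ Ioo 0 (Real.pi / 4)) {p : ℝ × ℝ} (hp : p ∈ rect)
    (h0 : s θ * p.2 ≤ t θ * p.1) (h1 : t θ * p.2 ≤ s θ * (1 - p.1)) :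
    p ∈ pieceA θ 0 ∨ p ∈ pieceB θ 1 := by
  rw [← rot_rotInv p, show (1 : Fin 4) = 0 + 1 from rfl, rot_mem_pieceB, rot_rotInv,
    mem_pieceA_zero hθ, mem_pieceB_zero hθ]
  have : 0 ≤ p.2 := hp.2.1
  by_cases h : (1 - s θ) * p.2 ≤ t θ * (1 - p.1)
  · exact .inl ⟨this, h0, h⟩
  · right
    push Not at h
    simp only [rotInv]
    exact ⟨h1, by linarith, by linarith⟩

theorem mem_piece_succ {i : Fin 4} {b : Bool} {p : ℝ × ℝ} :
    p ∈ piece θ (i + 1, b) ↔ rotInv p ∈ piece θ (i, b) := by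
  conv_lhs => rw [← rot_rotInv p]
  exact rot_mem_piece

theorem E_mem_breakSet (i : Fin 4) : E i ∈ breakSet θ :=
  ⟨i, .inl ⟨subset_convexHull _ _ (by simp), subset_convexHull _ _ (by simp)⟩⟩

/-! ### Distinct triangles meet only in break segments and in the centre square -/

/-- Neighbours share only a vertex of the unit square; opposite triangles are kept apart by `2 t <
1`. -/
theorem pieceA_zero_inter_pieceA (hθ : θ ∈ Ioo 0 (Real.pi / 4)) {p : ℝ × ℝ} {j : Fin 4}
    (hj : j ≠ 0) (h0 : p ∈ pieceA θ 0) (h1 : p ∈ pieceA θ j) : p ∈ breakSet θ := by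
  have ht := t_pos hθ
  have hst := t_lt_s hθ
  have hrel := st_rel θ
  have key : ∀ q : ℝ × ℝ, q ∈ pieceA θ 0 → q ∈ pieceA θ 1 → q ∈ breakSet θ := by
    intro q h0 h1
    change q ∈ piece θ (0 + 1, true) at h1
    rw [mem_piece_succ] at h1
    obtain ⟨a1, a2, a3⟩ := (mem_pieceA_zero hθ).1 h0
    obtain ⟨b1, b2, b3⟩ := (mem_pieceA_zero hθ).1 h1
    simp only [rotInv] at b1 b2 b3
    have hy : q.2 = 0 := by
      have : (s θ - t θ) * q.2 ≤ 0 := by nlinarith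
      nlinarith
    have hx : q.1 = 1 := by nlinarith
    convert E_mem_breakSet (θ := θ) 1
    ext <;> simp [E, hx, hy]
  fin_cases j
  · exact absurd rfl hj
  · exact key p h0 h1
  · change p ∈ piece θ (0 + 1 + 1, true) at h1
    rw [mem_piece_succ, mem_piece_succ] at h1
    obtain ⟨a1, a2, a3⟩ := (mem_pieceA_zero hθ).1 h0
    obtain ⟨b1, b2, b3⟩ := (mem_pieceA_zero hθ).1 h1
    simp only [rotInv] at b1 b2 b3
    nlinarith [two_mul_t_lt_one hθ]
  · rw [← rot_mem_breakSet]
    have h1' := (rot_mem_pieceA (i := 3)).2 h1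
    have h0' := (rot_mem_pieceA (i := 0)).2 h0
    rw [show (3 : Fin 4) + 1 = 0 from rfl] at h1'
    rw [zero_add] at h0'
    exact key _ h1' h0'

/-- Two of the triangles `pieceB` meet `pieceA θ 0` in break segments by definition; the other two
lie above height `t`, at heights at least `s` and `1 - s`. -/
theorem pieceA_zero_inter_pieceB (hθ : θ ∈ Ioo 0 (Real.pi / 4)) {p : ℝ × ℝ} {j : Fin 4}
    (h0 : p ∈ pieceA θ 0) (h1 : p ∈ pieceB θ j) : p ∈ breakSet θ := by
  have ht := t_pos hθ
  have hst := t_lt_s hθ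
  have hrel := st_rel θ
  have hst1 := s_add_t_lt_one hθ
  obtain ⟨a1, a2, a3⟩ := (mem_pieceA_zero hθ).1 h0
  have hy : p.2 ≤ t θ := by linarith
  fin_cases j
  · exact ⟨0, .inl ⟨h1, h0⟩⟩
  · exact ⟨0, .inr ⟨h0, h1⟩⟩
  · change p ∈ piece θ (0 + 1 + 1, false) at h1
    rw [mem_piece_succ, mem_piece_succ] at h1
    obtain ⟨b1, b2, b3⟩ := (mem_pieceB_zero hθ).1 h1
    simp only [rotInv] at b1 b2 b3
    exfalso
    have : t θ * (1 - p.2) ≤ t θ * (1 - s θ) := by nlinarith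
    have := le_of_mul_le_mul_left this ht
    linarith
  · change p ∈ piece θ (0 + 1 + 1 + 1, false) at h1
    rw [mem_piece_succ, mem_piece_succ, mem_piece_succ] at h1
    obtain ⟨b1, b2, b3⟩ := (mem_pieceB_zero hθ).1 h1
    simp only [rotInv] at b1 b2 b3
    exfalso
    have : t θ * (1 - p.2) ≤ t θ * s θ := by nlinarith
    have := le_of_mul_le_mul_left this ht
    linarith

/-- Neighbours share only a vertex of the centre square; opposite triangles are separated by the
line `x + y = 1`. -/
theorem pieceB_zero_inter_pieceB (hθ : θ ∈ Ioo 0 (Real.pi / 4)) {p : ℝ × ℝ} {j : Fin 4}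
    (hj : j ≠ 0) (h0 : p ∈ pieceB θ 0) (h1 : p ∈ pieceB θ j) : p ∈ pieceC θ := by
  have ht := t_pos hθ
  have hst := t_lt_s hθ
  have hrel := st_rel θ
  have hs1 := s_add_t_lt_one hθ
  have key : ∀ q : ℝ × ℝ, q ∈ pieceB θ 0 → q ∈ pieceB θ 1 → q ∈ pieceC θ := by
    intro q h0 h1
    change q ∈ piece θ (0 + 1, false) at h1
    rw [mem_piece_succ] at h1
    obtain ⟨a1, a2, a3⟩ := (mem_pieceB_zero hθ).1 h0
    obtain ⟨b1, b2, b3⟩ := (mem_pieceB_zero hθ).1 h1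
    simp only [rotInv] at b1 b2 b3
    have e : t θ * q.1 = s θ * q.2 := by linarith
    have hy : q.2 = t θ := by
      apply le_antisymm
      · have : t θ * q.2 ≤ t θ * t θ := by nlinarith
        exact le_of_mul_le_mul_left this ht
      · linarith
    have hx : q.1 = s θ := by
      rw [hy, mul_comm] at e
      exact mul_right_cancel₀ ht.ne' e
    convert P_mem_pieceC (θ := θ) 0
    ext <;> simp [P, hx, hy]
  have sum : ∀ q : ℝ × ℝ, q ∈ pieceB θ 0 → q.1 + q.2 < 1 := by
    intro q h
    obtain ⟨a1, a2, a3⟩ := (mem_pieceB_zero hθ).1 h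
    have : t θ * (q.1 + q.2) ≤ t θ * (1 - s θ + t θ) := by nlinarith
    have := le_of_mul_le_mul_left this ht
    linarith
  fin_cases j
  · exact absurd rfl hj
  · exact key p h0 h1
  · change p ∈ piece θ (0 + 1 + 1, false) at h1
    rw [mem_piece_succ, mem_piece_succ] at h1
    have := sum _ h0
    have := sum _ h1
    simp only [rotInv] at this
    linarith
  · rw [← rot_mem_pieceC]
    have h1' := (rot_mem_pieceB (i := 3)).2 h1
    have h0' := (rot_mem_pieceB (i := 0)).2 h0
    rw [show (3 : Fin 4) + 1 = 0 from rfl] at h1'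
    rw [zero_add] at h0'
    exact key _ h1' h0'

theorem piece_inter_piece (hθ : θ ∈ Ioo 0 (Real.pi / 4)) {k l : Fin 4 × Bool} (hkl : k ≠ l)
    {p : ℝ × ℝ} (hk : p ∈ piece θ k) (hl : p ∈ piece θ l) : p ∈ breakSet θ ∪ pieceC θ := by
  -- The side condition leaves out a `pieceB` followed by a `pieceA`; that case is recovered at the
  -- end by exchanging the two pieces.
  have zero : ∀ (p : ℝ × ℝ) (b : Bool) (l : Fin 4 × Bool), (b = true ∨ l.2 = false) →
      ((0, b) : Fin 4 × Bool) ≠ l → p ∈ piece θ (0, b) → p ∈ piece θ l →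
      p ∈ breakSet θ ∪ pieceC θ := by
    rintro p (_ | _) ⟨j, _ | _⟩ hb hne h0 h1
    · exact .inr (pieceB_zero_inter_pieceB hθ (fun h => hne (by simp [h])) h0 h1)
    · simp at hb
    · exact .inl (pieceA_zero_inter_pieceB hθ h0 h1)
    · exact .inl (pieceA_zero_inter_pieceA hθ (fun h => hne (by simp [h])) h0 h1)
  let Q : Fin 4 → Prop := fun i => ∀ (p : ℝ × ℝ) (b : Bool) (j : Fin 4) (b' : Bool),
    (b = true ∨ b' = false) → ((i, b) : Fin 4 × Bool) ≠ (j, b') →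
    p ∈ piece θ (i, b) → p ∈ piece θ (j, b') → p ∈ breakSet θ ∪ pieceC θ
  have step : ∀ i, Q i → Q (i + 1) := by
    intro i ih p b j b' hb hne h0 h1
    obtain ⟨j, rfl⟩ : ∃ j', j = j' + 1 := ⟨j - 1, by simp⟩
    rw [mem_piece_succ] at h0 h1
    rw [← rot_rotInv p]
    exact (ih (rotInv p) b j b' hb (fun h => hne (by simp_all)) h0 h1).imp
      rot_mem_breakSet.2 rot_mem_pieceC.2
  have h0 : Q 0 := fun p b j b' hb hne => zero p b (j, b') hb hne
  have h1 : Q 1 := step 0 h0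
  have h2 : Q 2 := step 1 h1
  have h3 : Q 3 := step 2 h2
  have hQ : ∀ i, Q i := by
    intro i; fin_cases i
    exacts [h0, h1, h2, h3]
  obtain ⟨i, b⟩ := k
  obtain ⟨j, b'⟩ := l
  by_cases hb : b = true ∨ b' = false
  · exact hQ i p b j b' hb hkl hk hl
  · exact hQ j p b' i b (by cases b <;> cases b' <;> simp_all) hkl.symm hl hk

/-! ### The triangles and the centre square cover the square -/

theorem rotInv_mem_rect {p : ℝ × ℝ} (hp : p ∈ rect) : rotInv p ∈ rect := by
  obtain ⟨⟨h1, h2⟩, h3, h4⟩ := hp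
  exact ⟨⟨h3, h4⟩, sub_nonneg.2 h2, sub_le_self _ h1⟩

theorem exists_mem_piece (hθ : θ ∈ Ioo 0 (Real.pi / 4)) {p : ℝ × ℝ} (hp : p ∈ rect)
    (hC : p ∉ pieceC θ) : ∃ k, p ∈ piece θ k := by
  have hst := t_lt_s hθ
  have key : ∀ q ∈ rect, (∃ k, q ∈ piece θ k) ∨
      ¬ (s θ * q.2 ≤ t θ * q.1 ∧ t θ * q.2 ≤ s θ * (1 - q.1)) := by
    intro q hq
    by_cases h : s θ * q.2 ≤ t θ * q.1 ∧ t θ * q.2 ≤ s θ * (1 - q.1)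
    · left
      rcases exists_rect_cover_zero hθ hq h.1 h.2 with h | h
      · exact ⟨(0, true), h⟩
      · exact ⟨(1, false), h⟩
    · exact .inr h
  have rotk : ∀ q, (∃ k, rotInv q ∈ piece θ k) → ∃ k, q ∈ piece θ k := by
    rintro q ⟨⟨i, b⟩, h⟩
    exact ⟨(i + 1, b), mem_piece_succ.2 h⟩
  by_contra hno
  have h0 := (key p hp).resolve_left hno
  have h1 := (key _ (rotInv_mem_rect hp)).resolve_left (fun h => hno (rotk _ h))
  have h2 := (key _ (rotInv_mem_rect (rotInv_mem_rect hp))).resolve_left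
    (fun h => hno (rotk _ (rotk _ h)))
  have h3 := (key _ (rotInv_mem_rect (rotInv_mem_rect (rotInv_mem_rect hp)))).resolve_left
    (fun h => hno (rotk _ (rotk _ (rotk _ h))))
  simp only [rotInv, not_and, not_le] at h0 h1 h2 h3
  apply hC
  refine mem_pieceC_of_le hθ ?_ ?_ ?_ ?_ <;> by_contra! hlt
  -- If one of the four inequalities fails, `h0`, ..., `h3` make all of them fail in turn, and their
  -- sum reads `2 s < 2 t`.
  · exact absurd (h0 hlt.le) (by grind)
  · exact absurd (h1 (by linarith)) (by grind)
  · exact absurd (h2 (by linarith)) (by grind)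
  · exact absurd (h3 (by linarith)) (by grind)

/-! ### The affine maps -/

/-- The affine map of `F θ` on `piece θ k`. -/
noncomputable def pieceMap (θ : ℝ) : Fin 4 × Bool → ℝ × ℝ → ℝ × ℝ
  | (i, true) => mapA θ i
  | (i, false) => mapB θ i

theorem F_eq_pieceMap (hθ : θ ∈ Ioo 0 (Real.pi / 4)) {k : Fin 4 × Bool} {p : ℝ × ℝ}
    (hC : p ∉ pieceC θ) (hb : p ∉ breakSet θ) (hk : p ∈ piece θ k) :
    F θ p = pieceMap θ k p := by
  have huniq : ∀ l, p ∈ piece θ l → l = k := fun l hl => by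
    by_contra hne
    exact (piece_inter_piece hθ hne hl hk).elim hb hC
  unfold F
  split_ifs with h h h h h h h h
  · rw [← huniq (0, true) h]; rfl
  · rw [← huniq (1, true) h]; rfl
  · rw [← huniq (2, true) h]; rfl
  · rw [← huniq (3, true) h]; rfl
  · rw [← huniq (0, false) h]; rfl
  · rw [← huniq (1, false) h]; rfl
  · rw [← huniq (2, false) h]; rfl
  · rw [← huniq (3, false) h]; rfl
  · obtain ⟨i, _ | _⟩ := k <;> fin_cases i <;> exact absurd hk ‹_›

/-- Break points are allowed here, at the price of not controlling `k`; this suffices for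
injectivity of the lift. -/
theorem exists_F_eq_pieceMap (hθ : θ ∈ Ioo 0 (Real.pi / 4)) {p : ℝ × ℝ} (hp : p ∈ rect)
    (hC : p ∉ pieceC θ) : ∃ k, F θ p = pieceMap θ k p := by
  unfold F
  split_ifs with h h h h h h h h
  · exact ⟨(0, true), rfl⟩
  · exact ⟨(1, true), rfl⟩
  · exact ⟨(2, true), rfl⟩
  · exact ⟨(3, true), rfl⟩
  · exact ⟨(0, false), rfl⟩
  · exact ⟨(1, false), rfl⟩
  · exact ⟨(2, false), rfl⟩
  · exact ⟨(3, false), rfl⟩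
  · obtain ⟨⟨i, _ | _⟩, hk⟩ := exists_mem_piece hθ hp hC <;> fin_cases i <;> exact absurd hk ‹_›

/-! ### Affine maps of determinant `1` and their bounded orbits. -/

/-- `f` is an affine self-map of the plane with linear part of determinant `1`. -/
def IsSpecialAffine (f : ℝ × ℝ → ℝ × ℝ) : Prop :=
  ∃ a b c d e k : ℝ, a * d - b * c = 1 ∧
    ∀ p, f p = (a * p.1 + b * p.2 + e, c * p.1 + d * p.2 + k)

namespace IsSpecialAffine

variable {f g : ℝ × ℝ → ℝ × ℝ}

theorem id : IsSpecialAffine id := ⟨1, 0, 0, 1, 0, 0, by norm_num, fun p => by simp⟩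

theorem comp (hf : IsSpecialAffine f) (hg : IsSpecialAffine g) : IsSpecialAffine (f ∘ g) := by
  obtain ⟨a, b, c, d, e, k, h, hf⟩ := hf
  obtain ⟨a', b', c', d', e', k', h', hg⟩ := hg
  refine ⟨a * a' + b * c', a * b' + b * d', c * a' + d * c', c * b' + d * d',
    a * e' + b * k' + e, c * e' + d * k' + k, by linear_combination (a' * d' - b' * c') * h + h',
    fun p => ?_⟩
  ext <;> simp [hf, hg] <;> ring

theorem iterate (hf : IsSpecialAffine f) : ∀ n : ℕ, IsSpecialAffine f^[n]
  | 0 => IsSpecialAffine.id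
  | n + 1 => (hf.iterate n).comp hf

theorem continuous (hf : IsSpecialAffine f) : Continuous f := by
  obtain ⟨a, b, c, d, e, k, -, hf⟩ := hf
  rw [funext hf]
  fun_prop

theorem injective (hf : IsSpecialAffine f) : Injective f := by
  obtain ⟨a, b, c, d, e, k, h, hf⟩ := hf
  intro p q hpq
  simp only [hf, Prod.mk.injEq] at hpq
  obtain ⟨h1, h2⟩ := hpq
  ext
  · linear_combination d * h1 - b * h2 - (p.1 - q.1) * h
  · linear_combination a * h2 - c * h1 - (p.2 - q.2) * h

/-- A special affine map with two fixed points is a shear along their line. -/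
theorem iterate_eq (hf : IsSpecialAffine f) {p q : ℝ × ℝ} (hp : f p = p) (hq : f q = q)
    (hpq : p ≠ q) (y : ℝ × ℝ) (n : ℕ) : f^[n] y = y + (n : ℝ) • (f y - y) := by
  obtain ⟨a, b, c, d, e, k, h, hf⟩ := hf
  have hp1 := congrArg Prod.fst ((hf p).symm.trans hp)
  have hp2 := congrArg Prod.snd ((hf p).symm.trans hp)
  have hq1 := congrArg Prod.fst ((hf q).symm.trans hq)
  have hq2 := congrArg Prod.snd ((hf q).symm.trans hq)
  dsimp only at hp1 hp2 hq1 hq2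
  -- With determinant `1`, the linear part minus the identity has determinant `2 - a - d`; were it
  -- nonzero, the fixed point would be unique.
  have htr : a + d = 2 := by
    by_contra hne
    have h0 : 2 - a - d ≠ 0 := fun h' => hne (by linarith)
    apply hpq
    ext
    · apply mul_left_cancel₀ h0
      linear_combination (d - 1) * (hp1 - hq1) - b * (hp2 - hq2) - (p.1 - q.1) * h
    · apply mul_left_cancel₀ h0
      linear_combination (a - 1) * (hp2 - hq2) - c * (hp1 - hq1) - (p.2 - q.2) * h
  obtain rfl : d = 2 - a := by linarith
  -- Trace `2` and determinant `1` make the linear part unipotent, so it fixes the displacement `f y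
  -- - y`.
  have hL1 : a * (f y - y).1 + b * (f y - y).2 = (f y - y).1 := by
    simp only [hf, Prod.fst_sub, Prod.snd_sub]
    linear_combination (a - 1) * hp1 + b * hp2 + (p.1 - y.1) * h
  have hL2 : c * (f y - y).1 + (2 - a) * (f y - y).2 = (f y - y).2 := by
    simp only [hf, Prod.fst_sub, Prod.snd_sub]
    linear_combination c * hp1 + (1 - a) * hp2 + (p.2 - y.2) * h
  induction n with
  | zero => simp
  | succ n ih =>
    rw [iterate_succ_apply', ih, hf]
    have hy := hf y
    have hy1 := congrArg Prod.fst hy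
    have hy2 := congrArg Prod.snd hy
    dsimp only at hy1 hy2
    ext
    · simp only [Prod.fst_add, Prod.snd_add, Prod.smul_fst, Prod.smul_snd, smul_eq_mul,
        Nat.cast_succ]
      simp only [Prod.fst_sub, Prod.snd_sub] at *
      linear_combination (n : ℝ) * hL1 - hy1
    · simp only [Prod.fst_add, Prod.snd_add, Prod.smul_fst, Prod.smul_snd, smul_eq_mul,
        Nat.cast_succ]
      simp only [Prod.fst_sub, Prod.snd_sub] at *
      linear_combination (n : ℝ) * hL2 - hy2

/-- By `iterate_eq` the orbit advances by a constant vector, which boundedness forces to vanish. -/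
theorem eq_of_bounded (hf : IsSpecialAffine f) {p q : ℝ × ℝ} (hp : f p = p) (hq : f q = q)
    (hpq : p ≠ q) {y : ℝ × ℝ} (hb : ∀ n : ℕ, f^[n] y ∈ rect) : f y = y := by
  have key : ∀ a v : ℝ, (∀ n : ℕ, a + n * v ∈ Icc (0 : ℝ) 1) → v = 0 := by
    intro a v h
    by_contra hv
    obtain ⟨n, hn⟩ := exists_nat_gt (1 / |v|)
    rw [div_lt_iff₀ (abs_pos.2 hv)] at hn
    have h0 := h 0
    have h1 := h n
    have : |n * v| ≤ 1 := abs_le.2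
      ⟨by simp at h0; linarith [h0.2, h1.1], by simp at h0; linarith [h0.1, h1.2]⟩
    rw [abs_mul, Nat.abs_cast] at this
    linarith
  have h : ∀ n : ℕ, y + (n : ℝ) • (f y - y) ∈ rect := fun n => by
    rw [← hf.iterate_eq hp hq hpq]; exact hb n
  rw [← sub_eq_zero]
  ext
  · exact key y.1 _ fun n => (h n).1
  · exact key y.2 _ fun n => (h n).2

end IsSpecialAffine

theorem isSpecialAffine_rot : IsSpecialAffine rot :=
  ⟨0, -1, 1, 0, 1, 0, by norm_num, fun p => by simp [rot]; ring⟩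

theorem isSpecialAffine_rotInv : IsSpecialAffine rotInv :=
  ⟨0, 1, -1, 0, 0, 1, by norm_num, fun p => by simp [rotInv]; ring⟩

theorem isSpecialAffine_shear : IsSpecialAffine (shear θ) :=
  ⟨1, (1 - 2 * s θ) / t θ, 0, 1, 0, 0, by norm_num, fun p => by simp [shear]⟩

/-- The pairs `P θ 0`, `P θ 3` and `P' θ 0`, `P' θ 3` span the same oriented area `s (1 - s) - t ^
2`. -/
theorem isSpecialAffine_scaling (hθ : θ ∈ Ioo 0 (Real.pi / 4)) :
    IsSpecialAffine (scaling θ) := by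
  have hst : t θ - s θ ≠ 0 := (sub_neg.2 (t_lt_s hθ)).ne
  have h := st_rel θ
  refine ⟨(t θ ^ 2 - (1 - s θ) ^ 2) / (t θ - s θ), (1 - 2 * s θ) * t θ / (t θ - s θ),
    (2 * s θ - 1) * t θ / (t θ - s θ), (2 * t θ - 1) * t θ / (t θ - s θ), 0, 0, ?_, fun p => ?_⟩
  · field_simp
    linear_combination (2 * t θ ^ 2 + t θ - 1) * h
  · ext <;> simp only [scaling] <;> ring

theorem isSpecialAffine_pieceMap (hθ : θ ∈ Ioo 0 (Real.pi / 4)) (k : Fin 4 × Bool) :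
    IsSpecialAffine (pieceMap θ k) := by
  obtain ⟨i, _ | _⟩ := k
  · exact (isSpecialAffine_rot.iterate i).comp
      ((isSpecialAffine_scaling hθ).comp (isSpecialAffine_rotInv.iterate i))
  · exact (isSpecialAffine_rot.iterate i).comp
      (isSpecialAffine_shear.comp (isSpecialAffine_rotInv.iterate i))

/-! ### Dynamics on the invariant circle -/

/-- Away from the break segments and the centre square the finitely many closed triangles are
disjoint, so a connected set cannot pass from one to another. -/
theorem exists_subset_piece (hθ : θ ∈ Ioo 0 (Real.pi / 4)) {T : Set (ℝ × ℝ)}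
    (hT : IsPreconnected T) (hne : T.Nonempty) (hr : T ⊆ rect) (hC : ∀ p ∈ T, p ∉ pieceC θ)
    (hb : ∀ p ∈ T, p ∉ breakSet θ) : ∃ k, T ⊆ piece θ k := by
  obtain ⟨x, hx⟩ := hne
  obtain ⟨k, hk⟩ := exists_mem_piece hθ (hr hx) (hC x hx)
  refine ⟨k, ?_⟩
  have hcl : IsClosed (⋃ l ∈ {l | l ≠ k}, piece θ l) :=
    (Set.toFinite _).isClosed_biUnion fun l _ => isClosed_piece θ l
  refine ((isPreconnected_iff_subset_of_disjoint_closed.1 hT) _ _ (isClosed_piece θ k) hcl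
    ?_ ?_).resolve_right ?_
  · intro p hp
    obtain ⟨l, hl⟩ := exists_mem_piece hθ (hr hp) (hC p hp)
    by_cases h : l = k
    · exact .inl (h ▸ hl)
    · exact .inr (mem_biUnion h hl)
  · rw [eq_empty_iff_forall_notMem]
    rintro p ⟨hp, hpk, hpl⟩
    simp only [mem_iUnion] at hpl
    obtain ⟨l, hl, hpl⟩ := hpl
    exact (piece_inter_piece hθ hl hpl hpk).elim (hb p hp) (hC p hp)
  · intro h
    have hpl := h hx
    simp only [mem_iUnion] at hpl
    obtain ⟨l, hl, hpl⟩ := hpl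
    exact (piece_inter_piece hθ hl hpl hk).elim (hb x hx) (hC x hx)

theorem exists_mem_breakSet (hθ : θ ∈ Ioo 0 (Real.pi / 4)) {Γ : Set (ℝ × ℝ)}
    (hΓ : IsPreconnected Γ) (hne : Γ.Nonempty) (hr : Γ ⊆ rect) (hC : ∀ p ∈ Γ, p ∉ pieceC θ)
    (hrot : rot '' Γ = Γ) : ∃ p ∈ Γ, p ∈ breakSet θ := by
  by_contra! hb
  obtain ⟨⟨i, b⟩, hk⟩ := exists_subset_piece hθ hΓ hne hr hC hb
  obtain ⟨p, hp⟩ := hne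
  have hp' : rot p ∈ Γ := hrot ▸ mem_image_of_mem rot hp
  have hne : ((i, b) : Fin 4 × Bool) ≠ (i + 1, b) := by simp
  exact (piece_inter_piece hθ hne (hk hp') (rot_mem_piece.2 (hk hp))).elim (hb _ hp') (hC _ hp')

theorem rot_ne_self (hθ : θ ∈ Ioo 0 (Real.pi / 4)) {p : ℝ × ℝ} (hp : p ∉ pieceC θ) :
    rot p ≠ p := by
  intro h
  have h1 := congrArg Prod.fst h
  have h2 := congrArg Prod.snd h
  simp only [rot] at h1 h2
  have hx : p.1 = 1 / 2 := by linarith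
  have hy : p.2 = 1 / 2 := by linarith
  have := t_lt_s hθ
  apply hp
  apply mem_pieceC_of_le hθ <;> rw [hx, hy] <;> linarith

/-! ### The lift of the circle dynamics to the real line. -/

theorem unitAddCircle_coe_eq_coe_iff {x y : ℝ} :
    (x : UnitAddCircle) = y ↔ ∃ m : ℤ, x = y + m := by
  rw [← sub_eq_zero, ← AddCircle.coe_sub, AddCircle.coe_eq_zero_iff]
  simp only [zsmul_eq_mul, mul_one]
  exact exists_congr fun m => ⟨fun h => by linarith, fun h => by linarith⟩

/-- A lift to the real line of the dynamics of `F θ` on a curve `range φ` in the unit square,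
disjoint from the centre square. -/
structure IsCurveLift (θ : ℝ) (φ : ℝ → ℝ × ℝ) (g : CircleDeg1Lift) : Prop where
  continuous : Continuous φ
  eq_iff : ∀ x y, φ x = φ y ↔ ∃ m : ℤ, x = y + m
  semiconj : Semiconj φ g (F θ)
  image : F θ '' range φ = range φ
  mem_rect : ∀ x, φ x ∈ rect
  notMem_pieceC : ∀ x, φ x ∉ pieceC θ

namespace IsCurveLift

variable {φ : ℝ → ℝ × ℝ} {g : CircleDeg1Lift}

theorem eq_of_abs_lt (h : IsCurveLift θ φ g) {x y : ℝ} (hxy : φ x = φ y) (hlt : |x - y| < 1) :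
    x = y := by
  obtain ⟨m, rfl⟩ := (h.eq_iff _ _).1 hxy
  rw [add_sub_cancel_left] at hlt
  have : |m| < 1 := by exact_mod_cast hlt
  rw [Int.abs_lt_one_iff.1 this]; simp

theorem surjective (h : IsCurveLift θ φ g) : Surjective g := by
  intro y
  obtain ⟨_, ⟨x, rfl⟩, hx⟩ := h.image.ge (mem_range_self y)
  rw [← h.semiconj x] at hx
  obtain ⟨m, hm⟩ := (h.eq_iff _ _).1 hx.symm
  exact ⟨x + m, by rw [g.map_add_int, hm]⟩

theorem continuous_lift (h : IsCurveLift θ φ g) : Continuous g :=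
  g.monotone.continuous_of_surjective h.surjective

theorem injective (hθ : θ ∈ Ioo 0 (Real.pi / 4)) (h : IsCurveLift θ φ g) : Injective g := by
  have key : ∀ x y, x < y → g x ≠ g y := by
    intro x y hxy heq
    choose k hk using fun z => exists_F_eq_pieceMap hθ (h.mem_rect z) (h.notMem_pieceC z)
    -- A monotone `g` with `g x = g y` is constant on `[x, y]`. Two of the infinitely many points
    -- there use the same affine map, which is injective; the bound `x + 1 / 2` keeps them within
    -- one period of `φ`.
    have hlt : x < min y (x + 1 / 2) := lt_min hxy (by linarith)
    obtain ⟨z, hz, w, hw, hzw, hkzw⟩ :=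
      (Icc_infinite hlt).exists_ne_map_eq_of_mapsTo (mapsTo_univ k _) finite_univ
    have hconst : ∀ z ∈ Icc x (min y (x + 1 / 2)), F θ (φ z) = φ (g x) := by
      intro z hz
      rw [← h.semiconj z]
      congr 1
      exact le_antisymm ((g.monotone (hz.2.trans (min_le_left _ _))).trans heq.ge)
        (g.monotone hz.1)
    have e : pieceMap θ (k z) (φ z) = pieceMap θ (k z) (φ w) := by
      rw [← hk z, hkzw, ← hk w, hconst z hz, hconst w hw]
    refine hzw (h.eq_of_abs_lt ((isSpecialAffine_pieceMap hθ _).injective e) ?_)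
    have h1 := hz.2.trans (min_le_right _ _)
    have h2 := hw.2.trans (min_le_right _ _)
    rw [abs_lt]
    constructor <;> linarith [hz.1, hw.1]
  intro x y hxy
  rcases lt_trichotomy x y with hlt | rfl | hlt
  · exact absurd hxy (key x y hlt)
  · rfl
  · exact absurd hxy.symm (key y x hlt)

/-- On an arc none of whose iterates meets a break segment, every iterate of `F θ` is affine. -/
theorem exists_iterate_eq (hθ : θ ∈ Ioo 0 (Real.pi / 4)) (h : IsCurveLift θ φ g) {a b : ℝ}
    (hab : a < b) (hb : ∀ z ∈ Ioo a b, ∀ j : ℕ, φ (g^[j] z) ∉ breakSet θ) (j : ℕ) :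
    ∃ M, IsSpecialAffine M ∧ ∀ z ∈ Ioo a b, (F θ)^[j] (φ z) = M (φ z) := by
  induction j with
  | zero => exact ⟨_, IsSpecialAffine.id, fun z _ => rfl⟩
  | succ j ih =>
    obtain ⟨M, hM, hMz⟩ := ih
    obtain ⟨k, hk⟩ : ∃ k, (fun z => φ (g^[j] z)) '' Ioo a b ⊆ piece θ k := by
      refine exists_subset_piece hθ (isPreconnected_Ioo.image _ ?_)
        ((nonempty_Ioo.2 hab).image _) ?_ ?_ ?_
      · exact (h.continuous.comp (h.continuous_lift.iterate j)).continuousOn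
      · rintro _ ⟨z, -, rfl⟩; exact h.mem_rect _
      · rintro _ ⟨z, -, rfl⟩; exact h.notMem_pieceC _
      · rintro _ ⟨z, hz, rfl⟩; exact hb z hz j
    refine ⟨_, (isSpecialAffine_pieceMap hθ k).comp hM, fun z hz => ?_⟩
    have hs := (h.semiconj.iterate_right j) z
    rw [iterate_succ_apply', comp_apply, ← hMz z hz, ← hs]
    exact F_eq_pieceMap hθ (h.notMem_pieceC _) (hb z hz j) (hk (mem_image_of_mem _ hz))

/-- If every break point is fixed by the `n`-th iterate of the circle map, so is every point,
provided that there are at least two fixed points. -/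
theorem iterate_eq_add_int (hθ : θ ∈ Ioo 0 (Real.pi / 4)) (h : IsCurveLift θ φ g) {n : ℕ} {m : ℤ}
    (hb : ∀ x, φ x ∈ breakSet θ → (g ^ n) x = x + m) {u v : ℝ} (huv : φ u ≠ φ v)
    (hu : (g ^ n) u = u + m) (hv : (g ^ n) v = v + m) (x : ℝ) : (g ^ n) x = x + m := by
  set G := g ^ n with hG
  have hGcont : Continuous G := by
    rw [hG, CircleDeg1Lift.coe_pow]; exact h.continuous_lift.iterate n
  set S : Set ℝ := {z | G z = z + m} with hS
  have hScl : IsClosed S := isClosed_eq hGcont (by fun_prop)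
  have hSadd : ∀ z ∈ S, ∀ k : ℤ, z + k ∈ S := fun z hz k => by
    change G (z + k) = z + k + m
    rw [G.map_add_int, show G z = z + m from hz]; ring
  by_contra hx
  have hxS : x ∉ S := hx
  -- Integer translates of `u` provide points of `S` on both sides of `x`, so `x` lies in a bounded
  -- gap of the closed set `S`.
  have hne1 : (S ∩ Iic x).Nonempty := by
    refine ⟨u + (-⌈u - x⌉ : ℤ), hSadd u hu _, ?_⟩
    have := Int.le_ceil (u - x)
    simp only [mem_Iic]; push_cast; linarith
  have hne2 : (S ∩ Ici x).Nonempty := by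
    refine ⟨u + (⌈x - u⌉ : ℤ), hSadd u hu _, ?_⟩
    have := Int.le_ceil (x - u)
    simp only [mem_Ici]; linarith
  have hbd1 : BddAbove (S ∩ Iic x) := ⟨x, fun z hz => hz.2⟩
  have hbd2 : BddBelow (S ∩ Ici x) := ⟨x, fun z hz => hz.2⟩
  obtain ⟨haS, hax⟩ := (hScl.inter isClosed_Iic).csSup_mem hne1 hbd1
  obtain ⟨hbS, hbx⟩ := (hScl.inter isClosed_Ici).csInf_mem hne2 hbd2
  have hgap' : ∀ z ∈ Ioo (sSup (S ∩ Iic x)) (sInf (S ∩ Ici x)), z ∉ S := by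
    intro z hz hzS
    rcases le_total z x with hzx | hzx
    · exact absurd (le_csSup hbd1 ⟨hzS, hzx⟩) (not_le.2 hz.1)
    · exact absurd (csInf_le hbd2 ⟨hzS, hzx⟩) (not_le.2 hz.2)
  generalize sSup (S ∩ Iic x) = a at haS hax hgap'
  generalize sInf (S ∩ Ici x) = b at hbS hbx hgap'
  have hax' : a < x := lt_of_le_of_ne hax fun e => hxS (e ▸ haS)
  have hxb' : x < b := lt_of_le_of_ne hbx fun e => hxS (e ▸ hbS)
  have hba : b ≤ a + 1 := by
    by_contra! hlt
    exact hgap' (a + 1) ⟨by linarith, hlt⟩ (by simpa using hSadd a haS 1)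
  -- Otherwise the gap has length `1`, `S` is a single class modulo the integers, and `φ u = φ v`.
  have hφab : φ a ≠ φ b := by
    intro e
    have hb1 : b = a + 1 := by
      by_contra hne
      have := h.eq_of_abs_lt e (by
        have := lt_of_le_of_ne hba hne
        rw [abs_lt]; constructor <;> linarith)
      linarith
    have key : ∀ w ∈ S, φ w = φ a := by
      intro w hw
      have h1 := Int.floor_le (w - a)
      have h2 := Int.lt_floor_add_one (w - a)
      have hwS := hSadd w hw (-⌊w - a⌋)
      refine (h.eq_iff _ _).2 ⟨⌊w - a⌋, ?_⟩
      by_contra hne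
      refine hgap' _ ⟨?_, ?_⟩ hwS
      · refine lt_of_le_of_ne ?_ fun e => hne ?_
        · push_cast; linarith
        · push_cast at e; linarith
      · push_cast; linarith
    exact huv ((key u hu).trans (key v hv).symm)
  -- If `g^[j] z` lies over a break point, it satisfies the equation defining `S`; since `g^[j]` is
  -- injective and commutes with `G` and with integer translations, `z` satisfies it too.
  have hbreak : ∀ z ∈ Ioo a b, ∀ j : ℕ, φ (g^[j] z) ∉ breakSet θ := by
    intro z hz j hj
    apply hgap' z hz
    have h1 := hb _ hj
    rw [hG, ← CircleDeg1Lift.coe_pow, ← CircleDeg1Lift.mul_apply, ← pow_add, add_comm, pow_add,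
      CircleDeg1Lift.mul_apply, ← CircleDeg1Lift.map_add_int] at h1
    rw [CircleDeg1Lift.coe_pow g j] at h1
    exact (h.injective hθ).iterate j h1
  obtain ⟨M, hM, hMz⟩ := h.exists_iterate_eq hθ (hax'.trans hxb') hbreak n
  -- Continuity extends the identity to the end points, which supply the two fixed points of `M`.
  have hφ : ∀ z ∈ Icc a b, φ (G z - m) = M (φ z) := by
    have hc1 : Continuous fun z => φ (G z - m) :=
      h.continuous.comp (hGcont.sub continuous_const)
    have hc2 : Continuous fun z => M (φ z) := hM.continuous.comp h.continuous
    have hcl := isClosed_eq hc1 hc2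
    rw [← closure_Ioo (hax'.trans hxb').ne]
    refine fun z hz => closure_minimal (fun z hz => ?_) hcl hz
    change φ (G z - m) = M (φ z)
    rw [← hMz z hz, ← (h.semiconj.iterate_right n) z, ← CircleDeg1Lift.coe_pow]
    exact (h.eq_iff _ _).2 ⟨-m, by push_cast; ring⟩
  have hmaps : MapsTo (fun z => G z - m) (Icc a b) (Icc a b) := by
    intro z hz
    have h1 := G.monotone hz.1
    have h2 := G.monotone hz.2
    rw [show G a = a + m from haS] at h1
    rw [show G b = b + m from hbS] at h2
    exact ⟨by simp only; linarith, by simp only; linarith⟩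
  have hx' : x ∈ Icc a b := ⟨hax, hbx⟩
  have hiter : ∀ k : ℕ, M^[k] (φ x) = φ ((fun z => G z - m)^[k] x) := by
    intro k
    induction k with
    | zero => rfl
    | succ k ih => rw [iterate_succ_apply', iterate_succ_apply', ih, hφ _ (hmaps.iterate k hx')]
  have ha' : M (φ a) = φ a := by
    rw [← hφ a ⟨le_rfl, (hax.trans hbx)⟩, show G a = a + m from haS, add_sub_cancel_right]
  have hb' : M (φ b) = φ b := by
    rw [← hφ b ⟨(hax.trans hbx), le_rfl⟩, show G b = b + m from hbS, add_sub_cancel_right]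
  have hfix : M (φ x) = φ x :=
    hM.eq_of_bounded ha' hb' hφab fun k => by rw [hiter]; exact h.mem_rect _
  rw [← hφ x hx'] at hfix
  have hm := hmaps hx'
  have := h.eq_of_abs_lt hfix (by
    rw [abs_lt]; constructor <;> linarith [hm.1, hm.2])
  exact hxS (by change G x = x + m; linarith)

theorem exists_pow_eq_of_periodic (h : IsCurveLift θ φ g) {x : ℝ}
    (hx : φ x ∈ periodicPts (F θ)) : ∃ n : ℕ, 0 < n ∧ ∃ m : ℤ, (g ^ n) x = x + m := by
  obtain ⟨n, hn, hp⟩ := hx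
  refine ⟨n, hn, ?_⟩
  rw [CircleDeg1Lift.coe_pow]
  exact (h.eq_iff _ _).1 (((h.semiconj.iterate_right n) x).trans hp)

end IsCurveLift

/-- All periodic points of a circle map have the same period and combinatorics. -/
theorem circleDeg1Lift_pow_eq_add_int {g : CircleDeg1Lift} {u v : ℝ} {n n' : ℕ} {m m' : ℤ}
    (hn : 0 < n) (hn' : 0 < n') (hu : (g ^ n) u = u + m) (hv : (g ^ n') v = v + m') :
    (g ^ n) v = v + m := by
  have h1 := g.translationNumber_of_map_pow_eq_add_int hu hn
  have h2 := g.translationNumber_of_map_pow_eq_add_int hv hn'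
  rw [h1, div_eq_div_iff (by positivity) (by positivity)] at h2
  -- Equal translation numbers give `m * n' = m' * n`. Both sides are compared after `n * n'` steps;
  -- for the monotone `g ^ n`, translation by `n' * m` after `n'` iterations already forces
  -- translation by `m` after one.
  rw [← (g ^ n).iterate_pos_eq_iff hn', ← CircleDeg1Lift.coe_pow, ← pow_mul, mul_comm, pow_mul,
    CircleDeg1Lift.coe_pow, (g ^ n').iterate_eq_of_map_eq_add_int hv n]
  linarith

end SquareMap

open SquareMap in
theorem proposition4p6 (θ : ℝ) (hθ : θ ∈ Set.Ioo 0 (Real.pi / 4)) (Γ : Set (ℝ × ℝ))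
    (hΓ : SquareMap.IsRotSymmInvariantCircle θ Γ) (hC : Disjoint Γ (SquareMap.pieceC θ)) :
    SquareMap.IsPeriodicOn (SquareMap.F θ) Γ ↔
      ∀ i : Fin 4,
        (∀ u ∈ SquareMap.breakU θ Γ i, u ∈ Function.periodicPts (SquareMap.F θ)) ∧
        (∀ v ∈ SquareMap.breakV θ Γ i, v ∈ Function.periodicPts (SquareMap.F θ)) := by
  constructor
  · rintro ⟨q, hq, h⟩ i
    exact ⟨fun u hu => Function.mk_mem_periodicPts hq (h u hu.1),
      fun v hv => Function.mk_mem_periodicPts hq (h v hv.1)⟩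
  · intro hper
    have hC' : ∀ p ∈ Γ, p ∉ pieceC θ := fun p hp => Set.disjoint_left.1 hC hp
    obtain ⟨γ, hγc, hγi, hγr, g, hg⟩ := hΓ.circle
    let φ : ℝ → ℝ × ℝ := fun x => γ (x : UnitAddCircle)
    have hφr : Set.range φ = Γ := by
      rw [← hγr]
      exact QuotientAddGroup.mk_surjective.range_comp γ
    have hφm : ∀ x, φ x ∈ Γ := fun x => hφr ▸ Set.mem_range_self x
    have h : IsCurveLift θ φ g :=
      { continuous := hγc.comp (AddCircle.continuous_mk' 1)
        eq_iff := fun x y => hγi.eq_iff.trans unitAddCircle_coe_eq_coe_iff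
        semiconj := fun x => (hg x).symm
        image := by rw [hφr]; exact hΓ.invariant
        mem_rect := fun x => hΓ.subset_rect (hφm x)
        notMem_pieceC := fun x => hC' _ (hφm x) }
    have hpb : ∀ x, φ x ∈ breakSet θ → φ x ∈ Function.periodicPts (F θ) := by
      rintro x ⟨i, hi | hi⟩
      · exact (hper i).1 _ ⟨hφm x, hi⟩
      · exact (hper i).2 _ ⟨hφm x, hi⟩
    obtain ⟨p, hp, hpB⟩ := exists_mem_breakSet hθ (hφr ▸ isPreconnected_range h.continuous)
      ⟨_, hφm 0⟩ hΓ.subset_rect hC' hΓ.rot_symm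
    -- The quarter turn supplies the second break point.
    have hp' : rot p ∈ Γ := hΓ.rot_symm ▸ Set.mem_image_of_mem rot hp
    have hpp := rot_ne_self hθ (hC' p hp)
    have hpB' := rot_mem_breakSet.2 hpB
    rw [← hφr] at hp hp'
    obtain ⟨u, rfl⟩ := hp
    obtain ⟨v, hv⟩ := hp'
    rw [← hv] at hpB' hpp
    obtain ⟨n, hn, m, hnm⟩ := h.exists_pow_eq_of_periodic (hpb u hpB)
    have hb : ∀ x, φ x ∈ breakSet θ → (g ^ n) x = x + m := fun x hx => by
      obtain ⟨n', hn', m', hnm'⟩ := h.exists_pow_eq_of_periodic (hpb x hx)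
      exact circleDeg1Lift_pow_eq_add_int hn hn' hnm hnm'
    refine ⟨n, hn, ?_⟩
    rw [← hφr]
    rintro _ ⟨x, rfl⟩
    rw [← (h.semiconj.iterate_right n) x, ← CircleDeg1Lift.coe_pow]
    exact (h.eq_iff _ _).2 ⟨m, h.iterate_eq_add_int hθ hb hpp.symm hnm (hb v hpB') x⟩
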